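/- Call a first-order sentence $\varphi$ over the vocabulary with one binary relation symbol $\sim$ (and equality) an \emph{$ae$-sentence} if $\varphi=\forall x\,\exists y\,\varphi'$ with $\varphi'$ quantifier-free. An \emph{undirected graph} is a pair $G=(V,E)$ with a finite nonempty vertex set $V$ and a symmetric relation $E\subseteq V\times V$ (so self-loops are allowed), regarded as a logical structure in which $\sim$ is interpreted by $E$. For a sentence $\varphi$, the parameterized problem $\mathrm{vd}_{\mathrm{undir}}(\varphi)\subseteq\{0,1\}^*\times\mathbb N$ consists of all pairs $(w,k)$ such that $w$ encodes, by its adjacency matrix, an undirected graph $G=(V,E)$ for which there is a set $S\subseteq V$ with $|S|\le k$ such that the induced substructure on $V\setminus S$ (possibly empty) satisfies $\varphi$; here $k$ is the parameter. Let $\mathrm{para\text{-}AC}^0$ be the class of parameterized problems $Q\subseteq\{0,1\}^*\times\mathbb N$ that can be decided by a family $(C_{n,k})_{n,k\in\mathbb N}$ of unbounded fan-in Boolean circuits (where $C_{n,k}$ decides the instances $(w,k)$ with $|w|=n$; no uniformity is required) of constant depth and of size $f(k)\cdot n^{O(1)}$ for some computable function $f\colon\mathbb N\to\mathbb N$. \textbf{Lemma.}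 For every $ae$-sentence $\varphi$, $\mathrm{vd}_{\mathrm{undir}}(\varphi)\in\mathrm{para\text{-}AC}^0$. That is, $\text{p-vertex-deletion}_{\mathrm{undir}}(ae)\subseteq\mathrm{para\text{-}AC}^0$, where the left-hand side is the class of all problems $\mathrm{vd}_{\mathrm{undir}}(\varphi)$ with $\varphi$ an $ae$-sentence. -/

import Mathlib

open FirstOrder

namespace VertexDeletion

/-! ### Unbounded fan-in Boolean circuits -/

/-- A gate of a circuit with `N` input bits whose gates are named by the elements of `V`.
The empty conjunction and the empty disjunction serve as the constants. -/
inductive Gate (N : ℕ) (V : Type) : Type where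
  | input (i : Fin N) : Gate N V
  | neg (u : V) : Gate N V
  | conj (s : Finset V) : Gate N V
  | disj (s : Finset V) : Gate N V

namespace Gate

variable {N : ℕ} {V : Type}

/-- The gates whose outputs are fed into the given gate. -/
def preds : Gate N V → Finset V
  | input _ => ∅
  | neg u => {u}
  | conj s => s
  | disj s => s

/-- The value of a gate on the input bits `x`, given the values of its predecessors. -/
def sem (x : Fin N → Bool) : (g : Gate N V) → ((u : V) → u ∈ g.preds → Prop) → Prop
  | input i, _ => x i = true
  | neg u, val => ¬ val u (Finset.mem_singleton_self u)
  | conj s, val => ∀ (u : V) (hu : u ∈ s), val u hu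
  | disj s, val => ∃ (u : V) (hu : u ∈ s), val u hu

end Gate

/-- A Boolean circuit with `N` input bits, unbounded fan-in and one output: a finite directed graph
of gates without directed cycles (for a finite graph, this is well-foundedness of the wire
relation). -/
structure Circuit (N : ℕ) where
  V : Type
  fintype : Fintype V
  gate : V → Gate N V
  acyclic : WellFounded (fun u v : V => u ∈ (gate v).preds)
  output : V

namespace Circuit

variable {N : ℕ}

/-- The size: the number of gates. -/
def size (C : Circuit N) : ℕ := @Fintype.card C.V C.fintype

/-- The depth of a gate: the length of the longest directed path that ends in it. -/
noncomputable def depthAt (C : Circuit N) : C.V → ℕ :=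
  C.acyclic.fix fun v d => (C.gate v).preds.attach.sup fun u => d u.1 u.2 + 1

/-- The depth of the circuit: the length of the longest directed path in it. -/
noncomputable def depth (C : Circuit N) : ℕ :=
  (@Finset.univ C.V C.fintype).sup C.depthAt

/-- The value computed at a gate. -/
def val (C : Circuit N) (x : Fin N → Bool) : C.V → Prop :=
  C.acyclic.fix fun v r => (C.gate v).sem x r

/-- The circuit accepts the input `x`. -/
def Accepts (C : Circuit N) (x : Fin N → Bool) : Prop := C.val x C.output

end Circuit

/-! ### Parameterized problems and the class para-AC⁰ -/

/-- A parameterized problem over the binary alphabet; in an instance `(w, k)`, the string `w` is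
the input and the number `k` is the parameter. -/
abbrev ParamProblem : Type := Set (List Bool × ℕ)

/-- The class para-AC⁰: the parameterized problems that are decided by a family of unbounded fan-in
circuits `C n k` (for inputs of length `n` and parameter `k`) of constant depth and of size
`f k * n ^ O(1)` for a computable function `f`. The base `n + 1` only matters for the empty
string: for `n ≥ 1` we have `n ^ c ≤ (n + 1) ^ c ≤ 2 ^ c * n ^ c`. -/
def ParaAC0 : Set ParamProblem :=
  {Q | ∃ (d c : ℕ) (f : ℕ → ℕ) (C : (n : ℕ) → (k : ℕ) → Circuit n),
    Computable f ∧
    ∀ n k : ℕ,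
      (C n k).depth ≤ d ∧
      (C n k).size ≤ f k * (n + 1) ^ c ∧
      ∀ x : Fin n → Bool, (C n k).Accepts x ↔ (List.ofFn x, k) ∈ Q}

/-! ### Quantifier patterns -/

/-- The two quantifiers: `a` stands for `∀` and `e` stands for `∃`. -/
inductive Quantifier : Type where
  | a
  | e

/-- `HasPattern p φ`: the formula `φ` is in prenex normal form, and `p` is the sequence of the
quantifiers at its front. -/
def HasPattern {L : Language} : List Quantifier → {n : ℕ} → L.BoundedFormula Empty n → Prop
  | [], _, φ => φ.IsQF
  | Quantifier.a :: p, n, φ => ∃ ψ : L.BoundedFormula Empty (n + 1), φ = ψ.all ∧ HasPattern p ψ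
  | Quantifier.e :: p, n, φ => ∃ ψ : L.BoundedFormula Empty (n + 1), φ = ψ.ex ∧ HasPattern p ψ

/-! ### Graphs as logical structures and vertex deletion -/

/-- A directed graph with vertex set `V` and edge relation `E`, self-loops allowed, as a structure
over the vocabulary that has one binary relation symbol. -/
abbrev graphStructure {V : Type} (E : V → V → Prop) : Language.graph.Structure V where
  funMap := fun f => nomatch f
  RelMap := fun r => match r with
    | .adj => fun x => E (x 0) (x 1)

/-- The graph with edge relation `E` is a model of the sentence `φ`. -/
def Models {V : Type} (E : V → V → Prop) (φ : Language.graph.Sentence) : Prop :=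
  @Language.Sentence.Realize Language.graph V (graphStructure E) φ

/-- The graph obtained by deleting the vertices in `S`, that is, the subgraph induced on the
complement of `S`. -/
def deleteVerts {V : Type} (E : V → V → Prop) (S : Finset V) :
    {v : V // v ∉ S} → {v : V // v ∉ S} → Prop :=
  fun u v => E u v

/-- The encoding of a graph with vertex set `Fin n` as a string of length `n * n`: the rows of its
adjacency matrix, one after the other. -/
def encode {n : ℕ} (A : Fin n → Fin n → Bool) : List Bool :=
  List.ofFn fun i : Fin (n * n) => A i.divNat i.modNat

/-- The problem vd_undir(φ): given an undirected graph (with a nonempty vertex set; self-loops are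
allowed) and a number `k`, the parameter, is there a set of at most `k` vertices whose deletion
yields a graph that satisfies `φ`? All vertices may be deleted if there are at most `k`. -/
def vdUndir (φ : Language.graph.Sentence) : ParamProblem :=
  {I | ∃ (n : ℕ) (A : Fin n → Fin n → Bool),
    0 < n ∧
    I.1 = encode A ∧
    (∀ u v : Fin n, A u v = true → A v u = true) ∧
    ∃ S : Finset (Fin n), S.card ≤ I.2 ∧
      Models (deleteVerts (fun u v => A u v = true) S) φ}

/-- The class of all problems vd_undir(φ) where `φ` has the quantifier pattern `p`. -/
def VDUndir (p : List Quantifier) : Set ParamProblem :=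
  {Q | ∃ φ : Language.graph.Sentence, HasPattern p φ ∧ Q = vdUndir φ}

end VertexDeletion

/-! Let `W x y` say that `ψ` holds at `(x, y)`. A set `S` solves the instance if every vertex
outside `S` has a `W`-witness outside `S`. Colour vertices by their loop bit. Since the graph is
undirected, `W` is symmetric between vertices of equal colour. Across the colours only the edge bit
is free, and `holds_trichotomy` leaves three cases: of any two such vertices one is a witness of the
other; `W` is symmetric there too; or vertices of one colour never have witnesses of the other.

In each case a single round of deleting witnessless vertices, started from a suitable subset `X` of
a solution, ends in a solution (`exists_isDeletionSet_iff`). In the last two cases an explicit `X`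
works. In the first, an inclusion-minimal solution contains all witnesses of its members, so these
have at most `k` witnesses each. By double counting, one colour has at most `2 * k` candidate
vertices, and `X` is the part of the solution among them.

Constant depth and size `f k * n ^ O(1)` suffice for all of this because a few vertices are
separated by the bits of their numbers at boundedly many positions. There are `(log n + 1) ^ g k`
choices of positions, which is at most `f k * (n + 1)` for a suitable `f`. Trying all of them
guesses `X` (`exists_hashSet`) and compares cardinalities with `k` (`card_le_iff_hash`). -/

namespace VertexDeletion

/-! ### Combining circuits -/

namespace Gate

variable {N : ℕ} {V V' : Type}

/-- Renaming the predecessors of a gate. -/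
def map (e : V ↪ V') : Gate N V → Gate N V'
  | input i => input i
  | neg u => neg (e u)
  | conj s => conj (s.map e)
  | disj s => disj (s.map e)

theorem preds_map (e : V ↪ V') (g : Gate N V) : (g.map e).preds = g.preds.map e := by
  cases g <;> simp [map, preds]

theorem sem_map (e : V ↪ V') (x : Fin N → Bool) (g : Gate N V) (p : V' → Prop) :
    (g.map e).sem x (fun u _ => p u) ↔ g.sem x (fun u _ => p (e u)) := by
  cases g <;> simp [map, sem]

theorem sem_congr (x : Fin N → Bool) (g : Gate N V) {p q : (u : V) → u ∈ g.preds → Prop}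
    (h : ∀ u hu, p u hu ↔ q u hu) : g.sem x p ↔ g.sem x q := by
  have : p = q := by
    funext u hu
    exact propext (h u hu)
  rw [this]

end Gate

namespace Circuit

variable {N : ℕ}

theorem val_iff (C : Circuit N) (x : Fin N → Bool) (v : C.V) :
    C.val x v ↔ (C.gate v).sem x (fun u _ => C.val x u) := by
  unfold val
  rw [WellFounded.fix_eq]

theorem depthAt_eq (C : Circuit N) (v : C.V) :
    C.depthAt v = (C.gate v).preds.sup fun u => C.depthAt u + 1 := by
  unfold depthAt
  rw [WellFounded.fix_eq]
  exact Finset.sup_attach (C.gate v).preds fun u => C.depthAt u + 1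

variable {ι : Type}

/-- The inclusion of the gates of one circuit into the gates of a combined circuit. -/
def gateEmb (C : ι → Circuit N) (i : ι) : (C i).V ↪ Option (Σ i, (C i).V) :=
  ⟨fun v => some ⟨i, v⟩, fun _ _ h => by simpa using h⟩

/-- The gates of the disjoint union of a family of circuits, and a new gate above them. -/
def combinedGate (C : ι → Circuit N) (g : Gate N (Σ i, (C i).V)) :
    Option (Σ i, (C i).V) → Gate N (Option (Σ i, (C i).V))
  | none => g.map Function.Embedding.some
  | some v => ((C v.1).gate v.2).map (gateEmb C v.1)

theorem combinedGate_wf (C : ι → Circuit N) (g : Gate N (Σ i, (C i).V)) :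
    WellFounded fun u v => u ∈ (combinedGate C g v).preds := by
  have key : ∀ (i : ι) (v : (C i).V),
      Acc (fun u v => u ∈ (combinedGate C g v).preds) (some ⟨i, v⟩) := by
    intro i v
    induction v using (C i).acyclic.induction with
    | _ v ih =>
      refine Acc.intro _ fun u hu => ?_
      simp only [combinedGate, Gate.preds_map, Finset.mem_map] at hu
      obtain ⟨w, hw, rfl⟩ := hu
      exact ih w hw
  refine ⟨fun v => ?_⟩
  rcases v with _ | ⟨i, v⟩
  · refine Acc.intro _ fun u hu => ?_
    simp only [combinedGate, Gate.preds_map, Finset.mem_map] at hu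
    obtain ⟨w, -, rfl⟩ := hu
    exact key w.1 w.2
  · exact key i v

/-- The disjoint union of a family of circuits together with a new output gate. -/
abbrev combine [Fintype ι] (C : ι → Circuit N) (g : Gate N (Σ i, (C i).V)) : Circuit N where
  V := Option (Σ i, (C i).V)
  fintype := by
    haveI := fun i => (C i).fintype
    infer_instance
  gate := combinedGate C g
  acyclic := combinedGate_wf C g
  output := none

theorem size_combine [Fintype ι] (C : ι → Circuit N) (g : Gate N (Σ i, (C i).V)) :
    (combine C g).size = (∑ i, (C i).size) + 1 := by
  let := fun i => (C i).fintype
  change Fintype.card (Option (Σ i, (C i).V)) = _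
  rw [Fintype.card_option, Fintype.card_sigma]
  rfl

theorem val_combine_some [Fintype ι] (C : ι → Circuit N) (g : Gate N (Σ i, (C i).V))
    (x : Fin N → Bool) (i : ι) (v : (C i).V) : (combine C g).val x (some ⟨i, v⟩) ↔ (C i).val x v := by
  induction v using (C i).acyclic.induction with
  | _ v ih =>
    refine (val_iff (combine C g) x _).trans (Iff.trans ?_ (val_iff (C i) x v).symm)
    exact (Gate.sem_map (gateEmb C i) x ((C i).gate v) _).trans
      (Gate.sem_congr _ _ fun u hu => ih u hu)

theorem depthAt_combine_some [Fintype ι] (C : ι → Circuit N) (g : Gate N (Σ i, (C i).V))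
    (i : ι) (v : (C i).V) : (combine C g).depthAt (some ⟨i, v⟩) = (C i).depthAt v := by
  induction v using (C i).acyclic.induction with
  | _ v ih =>
    refine (depthAt_eq (combine C g) _).trans (Eq.trans ?_ (depthAt_eq (C i) v).symm)
    change (((C i).gate v).map (gateEmb C i)).preds.sup _ = _
    rw [Gate.preds_map, Finset.sup_map]
    exact Finset.sup_congr rfl fun u hu => congrArg (· + 1) (ih u hu)

theorem accepts_combine [Fintype ι] (C : ι → Circuit N) (g : Gate N (Σ i, (C i).V))
    (x : Fin N → Bool) :
    (combine C g).Accepts x ↔ g.sem x (fun u _ => (C u.1).val x u.2) := by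
  refine (val_iff (combine C g) x none).trans ?_
  exact (Gate.sem_map Function.Embedding.some x g _).trans
    (Gate.sem_congr _ _ fun u _ => val_combine_some C g x u.1 u.2)

theorem depthAt_le_depth (C : Circuit N) (v : C.V) : C.depthAt v ≤ C.depth :=
  @Finset.le_sup _ _ _ _ (@Finset.univ C.V C.fintype) C.depthAt v (@Finset.mem_univ _ C.fintype v)

theorem depth_combine_le [Fintype ι] (C : ι → Circuit N) (g : Gate N (Σ i, (C i).V)) {d : ℕ}
    (hd : ∀ i, (C i).depth ≤ d) : (combine C g).depth ≤ d + 1 := by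
  refine Finset.sup_le fun v _ => ?_
  have key : ∀ (i : ι) (v : (C i).V), (combine C g).depthAt (some ⟨i, v⟩) ≤ d := fun i v =>
    (depthAt_combine_some C g i v).trans_le ((depthAt_le_depth _ v).trans (hd i))
  rcases v with _ | ⟨i, v⟩
  · refine (depthAt_eq (combine C g) none).trans_le ?_
    change (g.map Function.Embedding.some).preds.sup _ ≤ _
    rw [Gate.preds_map, Finset.sup_map]
    exact Finset.sup_le fun u _ => Nat.succ_le_succ (key u.1 u.2)
  · exact (key i v).trans (Nat.le_succ d)

end Circuit

/-- The predicate `P` on strings of length `N` is decided by a circuit of depth at most `d` and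
size at most `s`. -/
def HasCircuit {N : ℕ} (d s : ℕ) (P : (Fin N → Bool) → Prop) : Prop :=
  ∃ C : Circuit N, C.depth ≤ d ∧ C.size ≤ s ∧ ∀ x, C.Accepts x ↔ P x

namespace HasCircuit

variable {N d s : ℕ}

theorem mono {d' s' : ℕ} {P : (Fin N → Bool) → Prop} (h : HasCircuit d s P) (hd : d ≤ d')
    (hs : s ≤ s') : HasCircuit d' s' P :=
  let ⟨C, h1, h2, h3⟩ := h
  ⟨C, h1.trans hd, h2.trans hs, h3⟩

theorem input (i : Fin N) : HasCircuit 1 1 (fun x => x i = true) :=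
  ⟨Circuit.combine (ι := Empty) (fun e => e.elim) (Gate.input i),
    Circuit.depth_combine_le _ _ fun e => e.elim, by simp [Circuit.size_combine],
    fun x => Circuit.accepts_combine _ _ x⟩

theorem not {P : (Fin N → Bool) → Prop} (h : HasCircuit d s P) :
    HasCircuit (d + 1) (s + 1) (fun x => ¬ P x) := by
  obtain ⟨C, h1, h2, h3⟩ := h
  refine ⟨Circuit.combine (fun _ : Unit => C) (Gate.neg ⟨(), C.output⟩),
    Circuit.depth_combine_le _ _ fun _ => h1, by simpa [Circuit.size_combine] using h2,
    fun x => (Circuit.accepts_combine _ _ x).trans (not_congr (h3 x))⟩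

/-- Disjoint copies feed one new gate: quantifying over an index set multiplies the size by its
cardinality but adds only one level of depth. -/
theorem exists_index {ι : Type} [Fintype ι] {P : ι → (Fin N → Bool) → Prop}
    (h : ∀ i, HasCircuit d s (P i)) :
    HasCircuit (d + 1) (Fintype.card ι * s + 1) (fun x => ∃ i, P i x) := by
  choose C h1 h2 h3 using h
  let e : ι ↪ Σ i, (C i).V := ⟨fun i => ⟨i, (C i).output⟩, fun i j hij => congrArg Sigma.fst hij⟩
  refine ⟨Circuit.combine C (Gate.disj (Finset.univ.map e)), Circuit.depth_combine_le _ _ h1, ?_,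
    fun x => (Circuit.accepts_combine _ _ x).trans ?_⟩
  · rw [Circuit.size_combine]
    refine Nat.succ_le_succ ((Finset.sum_le_card_nsmul _ _ s fun i _ => h2 i).trans_eq ?_)
    simp
  · simp only [Gate.sem, Finset.mem_map, Finset.mem_univ, true_and, exists_prop,
      exists_exists_eq_and]
    exact exists_congr fun i => h3 i x

end HasCircuit

/-! ### Uniformly bounded families of circuits -/

theorem primrec_pow {f g : ℕ → ℕ} (hf : Primrec f) (hg : Primrec g) :
    Primrec fun k => f k ^ g k :=
  Primrec₂.comp (f := fun a b : ℕ => a ^ b) (Primrec₂.unpaired'.1 Nat.Primrec.pow) hf hg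

/-- A function of `n` and `k` that is bounded by `f k * n ^ O(1)` for a primitive recursive `f`. -/
def ParaBounded (s : ℕ → ℕ → ℕ) : Prop :=
  ∃ (c : ℕ) (f : ℕ → ℕ), Primrec f ∧ ∀ n k, s n k ≤ f k * (n + 1) ^ c

namespace ParaBounded

variable {s t : ℕ → ℕ → ℕ}

theorem mono (h : ParaBounded t) (hst : ∀ n k, s n k ≤ t n k) : ParaBounded s :=
  let ⟨c, f, hf, h⟩ := h
  ⟨c, f, hf, fun n k => (hst n k).trans (h n k)⟩

theorem of_primrec {f : ℕ → ℕ} (hf : Primrec f) : ParaBounded fun _ k => f k :=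
  ⟨0, f, hf, fun n k => by simp⟩

theorem const (a : ℕ) : ParaBounded fun _ _ => a := of_primrec (Primrec.const a)

theorem succ_left : ParaBounded fun n _ => n + 1 :=
  ⟨1, fun _ => 1, Primrec.const 1, fun n k => by simp⟩

theorem mul (hs : ParaBounded s) (ht : ParaBounded t) : ParaBounded fun n k => s n k * t n k := by
  obtain ⟨c, f, hf, hs⟩ := hs
  obtain ⟨e, g, hg, ht⟩ := ht
  refine ⟨c + e, fun k => f k * g k, Primrec.nat_mul.comp hf hg, fun n k => ?_⟩
  refine (Nat.mul_le_mul (hs n k) (ht n k)).trans_eq ?_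
  ring

theorem add (hs : ParaBounded s) (ht : ParaBounded t) : ParaBounded fun n k => s n k + t n k := by
  obtain ⟨c, f, hf, hs⟩ := hs
  obtain ⟨e, g, hg, ht⟩ := ht
  refine ⟨c + e, fun k => f k + g k, Primrec.nat_add.comp hf hg, fun n k => ?_⟩
  rw [add_mul]
  exact add_le_add
    ((hs n k).trans (Nat.mul_le_mul_left _ (Nat.pow_le_pow_right n.succ_pos (by lia))))
    ((ht n k).trans (Nat.mul_le_mul_left _ (Nat.pow_le_pow_right n.succ_pos (by lia))))

end ParaBounded

/-- A family of properties of graphs on `Fin n`, given by their adjacency matrices, that are decided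
by circuits of constant depth and of size `f k * n ^ O(1)`. -/
def ParaDefinable {ι : ℕ → ℕ → Type}
    (P : (n k : ℕ) → ι n k → (Fin n → Fin n → Bool) → Prop) : Prop :=
  ∃ (d : ℕ) (s : ℕ → ℕ → ℕ), ParaBounded s ∧ ∀ n k i,
    HasCircuit (N := n * n) d (s n k) fun x => P n k i fun u v => x (finProdFinEquiv (u, v))

namespace ParaDefinable

variable {ι κ : ℕ → ℕ → Type} {P Q : (n k : ℕ) → ι n k → (Fin n → Fin n → Bool) → Prop}

theorem congr (h : ParaDefinable P) (hPQ : ∀ n k i A, Q n k i A ↔ P n k i A) : ParaDefinable Q := by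
  have : Q = P := by
    funext n k i A
    exact propext (hPQ n k i A)
  rwa [this]

theorem comp (h : ParaDefinable P) (g : ∀ n k, κ n k → ι n k) :
    ParaDefinable fun n k j A => P n k (g n k j) A :=
  let ⟨d, s, hs, h⟩ := h
  ⟨d, s, hs, fun n k j => h n k (g n k j)⟩

theorem adj (u v : ∀ n k, ι n k → Fin n) :
    ParaDefinable fun n k i A => A (u n k i) (v n k i) = true :=
  ⟨1, fun _ _ => 1, .const 1, fun n k i =>
    HasCircuit.input (finProdFinEquiv (u n k i, v n k i))⟩

theorem not (h : ParaDefinable P) : ParaDefinable fun n k i A => ¬ P n k i A :=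
  let ⟨d, s, hs, h⟩ := h
  ⟨d + 1, fun n k => s n k + 1, hs.add (.const 1), fun n k i => (h n k i).not⟩

theorem exists_index [∀ n k, Fintype (κ n k)] (hκ : ParaBounded fun n k => Fintype.card (κ n k))
    {P : (n k : ℕ) → ι n k → κ n k → (Fin n → Fin n → Bool) → Prop}
    (h : ParaDefinable (ι := fun n k => ι n k × κ n k) fun n k p A => P n k p.1 p.2 A) :
    ParaDefinable fun n k i A => ∃ j, P n k i j A :=
  let ⟨d, s, hs, h⟩ := h
  ⟨d + 1, fun n k => Fintype.card (κ n k) * s n k + 1, (hκ.mul hs).add (.const 1), fun n k i =>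
    HasCircuit.exists_index fun j => h n k (i, j)⟩

theorem forall_index [∀ n k, Fintype (κ n k)] (hκ : ParaBounded fun n k => Fintype.card (κ n k))
    {P : (n k : ℕ) → ι n k → κ n k → (Fin n → Fin n → Bool) → Prop}
    (h : ParaDefinable (ι := fun n k => ι n k × κ n k) fun n k p A => P n k p.1 p.2 A) :
    ParaDefinable fun n k i A => ∀ j, P n k i j A :=
  (exists_index hκ (P := fun n k i j A => ¬ P n k i j A) h.not).not.congr fun n k i A => by
    push Not
    rfl

theorem exists_vertex {P : (n k : ℕ) → ι n k → Fin n → (Fin n → Fin n → Bool) → Prop}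
    (h : ParaDefinable (ι := fun n k => ι n k × Fin n) fun n k p A => P n k p.1 p.2 A) :
    ParaDefinable fun n k i A => ∃ v, P n k i v A :=
  exists_index (κ := fun n _ => Fin n) (ParaBounded.succ_left.mono fun n k => by simp) h

theorem forall_vertex {P : (n k : ℕ) → ι n k → Fin n → (Fin n → Fin n → Bool) → Prop}
    (h : ParaDefinable (ι := fun n k => ι n k × Fin n) fun n k p A => P n k p.1 p.2 A) :
    ParaDefinable fun n k i A => ∀ v, P n k i v A :=
  forall_index (κ := fun n _ => Fin n) (ParaBounded.succ_left.mono fun n k => by simp) h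

/-- Circuits are non-uniform, so a condition on the index alone, however complex, is hard-wired as a
constant. All conditions on hash functions enter this way. -/
theorem const (p : ∀ n k, ι n k → Prop) : ParaDefinable fun n k i _ => p n k i := by
  classical
  refine ⟨2, fun _ _ => 2, .const 2, fun n k i => ?_⟩
  have hF : HasCircuit (N := n * n) 1 1 fun _ => False := by
    have := HasCircuit.exists_index (N := n * n) (d := 0) (s := 0) (ι := Empty)
      (P := fun _ _ => True) fun e => e.elim
    simpa using this
  by_cases hp : p n k i
  · simpa [hp] using hF.not
  · simpa [hp] using hF.mono (d' := 2) (s' := 2) (by lia) (by lia)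

theorem or (hP : ParaDefinable P) (hQ : ParaDefinable Q) :
    ParaDefinable fun n k i A => P n k i A ∨ Q n k i A := by
  obtain ⟨d, s, hs, hP⟩ := hP
  obtain ⟨e, t, ht, hQ⟩ := hQ
  have : ParaDefinable (ι := fun n k => ι n k × Bool) fun n k p A =>
      bif p.2 then P n k p.1 A else Q n k p.1 A := by
    refine ⟨max d e, fun n k => s n k + t n k, hs.add ht, ?_⟩
    rintro n k ⟨i, b⟩
    cases b
    · exact (hQ n k i).mono (le_max_right _ _) (Nat.le_add_left _ _)
    · exact (hP n k i).mono (le_max_left _ _) (Nat.le_add_right _ _)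
  refine (exists_index (κ := fun _ _ => Bool) (.const 2)
    (P := fun n k i b A => bif b then P n k i A else Q n k i A) this).congr fun n k i A => ?_
  simp [or_comm]

theorem and (hP : ParaDefinable P) (hQ : ParaDefinable Q) :
    ParaDefinable fun n k i A => P n k i A ∧ Q n k i A :=
  (hP.not.or hQ.not).not.congr fun n k i A => by tauto

theorem imp (hP : ParaDefinable P) (hQ : ParaDefinable Q) :
    ParaDefinable fun n k i A => P n k i A → Q n k i A :=
  (hP.not.or hQ).congr fun n k i A => by tauto

theorem adj_eq (u v : ∀ n k, ι n k → Fin n) (b : ∀ n k, ι n k → Bool) :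
    ParaDefinable fun n k i A => A (u n k i) (v n k i) = b n k i :=
  (((adj u v).and (const fun n k i => b n k i = true)).or
    ((adj u v).not.and (const fun n k i => ¬ b n k i = true))).congr fun n k i A => by
      cases A (u n k i) (v n k i) <;> cases b n k i <;> simp

end ParaDefinable

/-! ### Hashing by the bits at a few positions -/

/-- The bits of `v` at the positions `p`. -/
def bitsAt {m l : ℕ} (p : Fin m → Fin l) (v : ℕ) : Fin m → Bool := fun j => v.testBit (p j)

/-- Record one differing bit for each pair of distinct elements; there are at most `m * m` pairs. -/
theorem exists_bitsAt_injOn {m l : ℕ} (hl : 0 < l) (X : Finset ℕ) (hX : X.card ≤ m)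
    (hlt : ∀ v ∈ X, v < 2 ^ l) : ∃ p : Fin (m * m) → Fin l, Set.InjOn (bitsAt p) X := by
  have hb : ∀ q : ℕ × ℕ, ∃ j : Fin l, q ∈ X ×ˢ X → q.1 ≠ q.2 →
      q.1.testBit j ≠ q.2.testBit j := by
    intro q
    by_cases hq : q ∈ X ×ˢ X ∧ q.1 ≠ q.2
    · obtain ⟨hq, hne⟩ := hq
      rw [Finset.mem_product] at hq
      obtain ⟨j, hj⟩ := Nat.exists_testBit_ne_of_ne hne
      refine ⟨⟨j, ?_⟩, fun _ _ => hj⟩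
      by_contra hjl
      have h2 : 2 ^ l ≤ 2 ^ j := Nat.pow_le_pow_right (by lia) (not_lt.1 hjl)
      exact hj (by rw [Nat.testBit_lt_two_pow ((hlt _ hq.1).trans_le h2),
        Nat.testBit_lt_two_pow ((hlt _ hq.2).trans_le h2)])
    · exact ⟨⟨0, hl⟩, fun h1 h2 => (hq ⟨h1, h2⟩).elim⟩
  choose b hb using hb
  have hc : (X ×ˢ X).card ≤ m * m := by
    rw [Finset.card_product]
    exact Nat.mul_le_mul hX hX
  -- Surplus indices get the dummy position `0`.
  refine ⟨fun j => if h : (j : ℕ) < (X ×ˢ X).card then b ((X ×ˢ X).equivFin.symm ⟨j, h⟩)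
    else ⟨0, hl⟩, fun x hx y hy hxy => ?_⟩
  by_contra hne
  have hq : (x, y) ∈ X ×ˢ X := Finset.mem_product.2 ⟨hx, hy⟩
  let i := (X ×ˢ X).equivFin ⟨(x, y), hq⟩
  have := congrFun hxy ⟨i, i.2.trans_le hc⟩
  simp only [bitsAt, i, Fin.is_lt, dite_true, Fin.eta, Equiv.symm_apply_apply] at this
  exact hb (x, y) hq hne this

/-- The number of bits needed for the numbers below `n`. -/
def bitLength (n : ℕ) : ℕ := Nat.log 2 n + 1

theorem lt_two_pow_bitLength {n : ℕ} (v : Fin n) : (v : ℕ) < 2 ^ bitLength n :=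
  v.2.trans (Nat.lt_pow_succ_log_self (by lia) n)

theorem two_pow_bitLength_le (n : ℕ) : 2 ^ bitLength n ≤ 2 * (n + 1) := by
  rcases Nat.eq_zero_or_pos n with rfl | hn
  · simp [bitLength]
  · have := Nat.pow_log_le_self 2 hn.ne'
    rw [bitLength, pow_succ]
    lia

/-- The number of positions that suffice to separate `2 * k + 1` numbers. -/
def numPos (k : ℕ) : ℕ := (2 * k + 1) * (2 * k + 1)

theorem primrec_numPos : Primrec numPos :=
  have h : Primrec fun k => 2 * k + 1 := Primrec.succ.comp (Primrec.nat_mul.comp (.const 2) .id)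
  Primrec.nat_mul.comp h h

/-- The choices of positions for hashing. -/
abbrev Positions (n k : ℕ) : Type := Fin (numPos k) → Fin (bitLength n)

/-- The hash values. -/
abbrev HashValue (k : ℕ) : Type := Fin (numPos k) → Bool

/-- With `l` the bit length of `n`, the factor `2 ^ l` is linear in `n` and the rest depends on the
parameter alone. -/
theorem pow_le_pow_mul_two_pow (l m : ℕ) : l ^ m ≤ m ^ m * 2 ^ (l + m) := by
  calc l ^ m ≤ l.ascFactorial m := Nat.pow_succ_le_ascFactorial l m
    _ = m.factorial * (l + m - 1).choose m := Nat.ascFactorial_eq_factorial_mul_choose' l m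
    _ ≤ m ^ m * 2 ^ (l + m) := Nat.mul_le_mul (Nat.factorial_le_pow m)
        ((Nat.choose_le_two_pow _ _).trans (Nat.pow_le_pow_right (by lia) (by lia)))

theorem paraBounded_positions : ParaBounded fun n k => Fintype.card (Positions n k) := by
  have h1 := ParaBounded.of_primrec (primrec_pow primrec_numPos primrec_numPos)
  have h2 := ParaBounded.of_primrec (primrec_pow (.const 2) primrec_numPos)
  refine ((h1.mul h2).mul ((ParaBounded.const 2).mul .succ_left)).mono fun n k => ?_
  simp only [Positions, Fintype.card_fun, Fintype.card_fin]
  refine (pow_le_pow_mul_two_pow _ _).trans ?_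
  rw [pow_add, mul_assoc, mul_comm (2 ^ bitLength n)]
  exact Nat.mul_le_mul_left _ (Nat.mul_le_mul_left _ (two_pow_bitLength_le n))

theorem exists_positions {n k : ℕ} (X : Finset (Fin n)) (hX : X.card ≤ 2 * k + 1) :
    ∃ p : Positions n k, ∀ u ∈ X, ∀ v ∈ X, bitsAt p u = bitsAt p v → u = v := by
  obtain ⟨p, hp⟩ := exists_bitsAt_injOn (m := 2 * k + 1) (l := bitLength n) (Nat.succ_pos _)
    (X.map Fin.valEmbedding) (by rwa [Finset.card_map]) (by
      intro v hv
      obtain ⟨u, -, rfl⟩ := Finset.mem_map.1 hv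
      exact lt_two_pow_bitLength u)
  refine ⟨p, fun u hu v hv h => Fin.ext (hp ?_ ?_ h)⟩
  · exact Finset.mem_coe.2 (Finset.mem_map_of_mem Fin.valEmbedding hu)
  · exact Finset.mem_coe.2 (Finset.mem_map_of_mem Fin.valEmbedding hv)

/-- The choices of a set of vertices by hashing. -/
abbrev HashSet (n k : ℕ) : Type := Positions n k × (HashValue k → Bool)

/-- The set of vertices chosen by hashing. -/
def HashSet.Mem {n k : ℕ} (F : HashSet n k) (v : Fin n) : Prop := F.2 (bitsAt F.1 v) = true

theorem paraBounded_hashSet : ParaBounded fun n k => Fintype.card (HashSet n k) := by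
  have h := ParaBounded.of_primrec
    (primrec_pow (.const 2) (primrec_pow (.const 2) primrec_numPos))
  refine (paraBounded_positions.mul h).mono fun n k => ?_
  simp [Fintype.card_prod]

/-- Choose positions that separate `X` and mark the hash values of `Y`. Outside `X` the hashed set
is uncontrolled. -/
theorem exists_hashSet {n k : ℕ} (X Y : Finset (Fin n)) (hYX : Y ⊆ X) (hX : X.card ≤ 2 * k) :
    ∃ F : HashSet n k, ∀ v ∈ X, F.Mem v ↔ v ∈ Y := by
  classical
  obtain ⟨p, hp⟩ := exists_positions X (hX.trans (Nat.le_succ _))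
  refine ⟨(p, fun c => decide (∃ u ∈ Y, bitsAt p u = c)), fun v hv => ?_⟩
  simp only [HashSet.Mem, decide_eq_true_eq]
  exact ⟨fun ⟨u, hu, h⟩ => hp u (hYX hu) v hv h ▸ hu, fun h => ⟨v, h, rfl⟩⟩

/-- Elements with distinct hash values are distinct, so `k + 1` attained values refute the bound;
conversely `k + 1` elements are separated by some positions. -/
theorem card_le_iff_hash {n k : ℕ} (X : Finset (Fin n)) :
    X.card ≤ k ↔ ∀ q : Positions n k × (Fin (k + 1) → HashValue k),
      Function.Injective q.2 → ∃ j, ∀ v, v ∈ X → bitsAt q.1 v ≠ q.2 j := by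
  constructor
  · rintro hX ⟨p, g⟩ hg
    by_contra! hcon
    choose v hv hvg using hcon
    have := Finset.card_le_card_of_injOn (s := Finset.univ) (t := X) v (fun j _ => hv j)
      (fun i _ j _ hij => hg (by rw [← hvg i, ← hvg j, hij]))
    simp at this
    lia
  · intro h
    by_contra! hcon
    obtain ⟨Y, hY, hYc⟩ := Finset.exists_subset_card_eq (Nat.succ_le_of_lt hcon)
    -- `Y` has `k + 1` elements. This is why `numPos` is built on `2 * k + 1` and not `2 * k`, which
    -- is too small for `k = 0`.
    obtain ⟨p, hp⟩ := exists_positions (k := k) Y (by lia)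
    let e : Fin (k + 1) ≃ Y := (Y.equivFinOfCardEq hYc).symm
    obtain ⟨j, hj⟩ := h (p, fun j => bitsAt p (e j)) fun i j hij =>
      e.injective (Subtype.ext (hp _ (e i).2 _ (e j).2 hij))
    exact hj (e j) (hY (e j).2) rfl

theorem ParaDefinable.ncard_le {ι : ℕ → ℕ → Type}
    {P : (n k : ℕ) → ι n k → Fin n → (Fin n → Fin n → Bool) → Prop}
    (h : ParaDefinable (ι := fun n k => ι n k × Fin n) fun n k p A => P n k p.1 p.2 A) :
    ParaDefinable fun n k i A => {v | P n k i v A}.ncard ≤ k := by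
  classical
  have hval : ParaBounded fun n k =>
      Fintype.card (Positions n k × (Fin (k + 1) → HashValue k)) := by
    have h := ParaBounded.of_primrec
      (primrec_pow (primrec_pow (.const 2) primrec_numPos) Primrec.succ)
    refine (paraBounded_positions.mul h).mono fun n k => ?_
    simp [Fintype.card_prod]
  have hfin : ParaBounded fun _ k => Fintype.card (Fin (k + 1)) :=
    (ParaBounded.of_primrec Primrec.succ).mono fun n k => by simp
  have key : ParaDefinable fun n k (i : ι n k) A =>
      ∀ q : Positions n k × (Fin (k + 1) → HashValue k), Function.Injective q.2 →
        ∃ j, ∀ v, P n k i v A → bitsAt q.1 v ≠ q.2 j := by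
    refine forall_index hval (imp (const _) ?_)
    refine exists_index hfin (forall_vertex (imp ?_ (const _)))
    exact h.comp fun n k (p : ((ι n k × (Positions n k × (Fin (k + 1) → HashValue k))) ×
      Fin (k + 1)) × Fin n) => (p.1.1.1, p.2)
  refine key.congr fun n k i A => ?_
  rw [Set.ncard_eq_toFinset_card', card_le_iff_hash]
  simp

/-! ### Deletion sets for a witness relation on two-coloured vertices -/

section Witness

variable {V : Type} (W : V → V → Prop)

/-- Outside of `S`, every vertex has a witness outside of `S`. -/
def IsDeletionSet (S : Set V) : Prop := ∀ v, v ∉ S → ∃ w, w ∉ S ∧ W v w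

/-- Add to `X` all vertices without a witness outside of `X`. -/
def deletionRound (X : Set V) : Set V := {v | v ∈ X ∨ ∀ w, w ∉ X → ¬ W v w}

/-- The vertices of colour `c` with at most `k` witnesses of the other colour. -/
def fewWitnesses (col : V → Bool) (k : ℕ) (c : Bool) : Set V :=
  {v | col v = c ∧ {w | col w = (!c) ∧ W v w}.ncard ≤ k}

variable {W} {col : V → Bool}

/-- A vertex with no witness outside `X` has none outside the larger set `S`, so it is forced into
`S`. -/
theorem deletionRound_subset {S X : Set V} (hS : IsDeletionSet W S) (hX : X ⊆ S) :
    deletionRound W X ⊆ S := by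
  rintro v (hv | hv)
  · exact hX hv
  · by_contra hvS
    obtain ⟨w, hw, hvw⟩ := hS v hvS
    exact hv w (fun h => hw (hX h)) hvw

theorem exists_of_notMem_deletionRound {X : Set V} {v : V} (hv : v ∉ deletionRound W X) :
    v ∉ X ∧ ∃ w, w ∉ X ∧ W v w := by
  simpa [deletionRound, not_or] using hv

theorem notMem_deletionRound {X : Set V} {v w : V} (hv : v ∉ X) (hw : w ∉ X) (h : W v w) :
    v ∉ deletionRound W X := by
  rintro (h' | h')
  exacts [hv h', h' w hw h]

/-- The round stays inside `S`, so surviving vertices of colour `c` keep their witnesses from `S`. A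
survivor of the other colour has a witness outside `S ∩ {v | col v = c}`: if that has colour `c`, it
lies outside `S`; otherwise the two are witnesses of each other and survive together. -/
theorem isDeletionSet_deletionRound_inter {S : Set V} (hS : IsDeletionSet W S)
    (hsame : ∀ x y, col x = col y → W x y → W y x) (c : Bool) :
    IsDeletionSet W (deletionRound W (S ∩ {v | col v = c})) := by
  have hsub : deletionRound W (S ∩ {v | col v = c}) ⊆ S :=
    deletionRound_subset hS Set.inter_subset_left
  intro v hv
  obtain ⟨hvX, w, hwX, hvw⟩ := exists_of_notMem_deletionRound hv
  by_cases hvc : col v = c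
  · obtain ⟨w', hw', hvw'⟩ := hS v fun h => hvX ⟨h, hvc⟩
    exact ⟨w', fun h => hw' (hsub h), hvw'⟩
  · refine ⟨w, ?_, hvw⟩
    by_cases hwc : col w = c
    · exact fun h => hwX ⟨hsub h, hwc⟩
    · refine notMem_deletionRound hwX hvX (hsame v w ?_ hvw)
      revert hvc hwc
      cases col v <;> cases col w <;> cases c <;> simp

theorem isDeletionSet_deletionRound_of_symm (hsymm : ∀ x y, W x y → W y x) (X : Set V) :
    IsDeletionSet W (deletionRound W X) := by
  intro v hv
  obtain ⟨hvX, w, hwX, hvw⟩ := exists_of_notMem_deletionRound hv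
  exact ⟨w, notMem_deletionRound hwX hvX (hsymm v w hvw), hvw⟩

/-- Colour `c` relies only on itself, and symmetrically so: removing its witnessless vertices
settles it once and for all. After that, the other colour needs just one round. -/
theorem isDeletionSet_deletionRound_of_independent
    (hsame : ∀ x y, col x = col y → W x y → W y x) {c : Bool}
    (hind : ∀ x y, col x = c → col y = (!c) → ¬ W x y) :
    IsDeletionSet W (deletionRound W (deletionRound W ∅ ∩ {v | col v = c})) := by
  intro v hv
  obtain ⟨hvX, w, hwX, hvw⟩ := exists_of_notMem_deletionRound hv
  refine ⟨w, ?_, hvw⟩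
  by_cases hcol : col v = col w
  · exact notMem_deletionRound hwX hvX (hsame v w hcol hvw)
  by_cases hwc : col w = c
  · have hw : w ∉ deletionRound W ∅ := fun h => hwX ⟨h, hwc⟩
    obtain ⟨-, w', -, hww'⟩ := exists_of_notMem_deletionRound hw
    have hw'c : col w' = c := by
      by_contra h
      exact hind w w' hwc (Bool.eq_not.2 h) hww'
    have hw' : w' ∉ deletionRound W ∅ := notMem_deletionRound (Set.notMem_empty _)
      (Set.notMem_empty _) (hsame w w' (hwc.trans hw'c.symm) hww')
    exact notMem_deletionRound hwX (fun h => hw' h.1) hww'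
  · refine (hind v w ?_ (Bool.eq_not.2 hwc) hvw).elim
    revert hcol hwc
    cases col v <;> cases col w <;> cases c <;> simp

/-- A deletion set that is minimal under inclusion is closed under losing witnesses. -/
theorem exists_isDeletionSet_closed [Fintype V] {k : ℕ} (h : ∃ S, S.ncard ≤ k ∧ IsDeletionSet W S) :
    ∃ S, S.ncard ≤ k ∧ IsDeletionSet W S ∧ ∀ v ∈ S, ∀ w, W v w → w ∈ S := by
  obtain ⟨S, ⟨hSk, hS⟩, hmin⟩ :=
    (Set.toFinite {S : Set V | S.ncard ≤ k ∧ IsDeletionSet W S}).exists_minimal h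
  refine ⟨S, hSk, hS, fun v hv w hvw => ?_⟩
  by_contra hw
  -- A vertex of `S` with a witness outside `S` could be put back, against minimality.
  have hdel : IsDeletionSet W (S \ {v}) := by
    intro u hu
    by_cases huv : u = v
    · exact ⟨w, fun h => hw h.1, huv ▸ hvw⟩
    · obtain ⟨w', hw', huw'⟩ := hS u fun h => hu ⟨h, huv⟩
      exact ⟨w', fun h => hw' h.1, huw'⟩
  have := hmin ⟨(Set.ncard_le_ncard Set.sdiff_subset S.toFinite).trans hSk, hdel⟩
    Set.sdiff_subset hv
  exact this.2 rfl

theorem inter_subset_fewWitnesses [Fintype V] {S : Set V} {k : ℕ} (hSk : S.ncard ≤ k)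
    (hcl : ∀ v ∈ S, ∀ w, W v w → w ∈ S) (c : Bool) :
    S ∩ {v | col v = c} ⊆ fewWitnesses W col k c :=
  fun v hv => ⟨hv.2, (Set.ncard_le_ncard (fun w hw => hcl v hv.1 w hw.2) S.toFinite).trans hSk⟩

/-- Double counting: if of any two vertices of different colours, one is a witness of the other,
then one of the colours has few vertices with few witnesses. -/
theorem exists_ncard_fewWitnesses_le [Fintype V] (k : ℕ)
    (h : ∀ x y, col x = true → col y = false → W x y ∨ W y x) :
    ∃ c, (fewWitnesses W col k c).ncard ≤ 2 * k := by
  classical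
  let A := (fewWitnesses W col k true).toFinset
  let B := (fewWitnesses W col k false).toFinset
  have hA : ∀ x ∈ A, (B.filter fun y => W x y).card ≤ k := by
    intro x hx
    have hx := (Set.mem_toFinset.1 hx).2
    rw [← Set.ncard_coe_finset]
    refine (Set.ncard_le_ncard ?_ (Set.toFinite _)).trans hx
    intro y hy
    have hy := Finset.mem_filter.1 (Finset.mem_coe.1 hy)
    exact ⟨(Set.mem_toFinset.1 hy.1).1, hy.2⟩
  have hB : ∀ y ∈ B, (A.filter fun x => W y x).card ≤ k := by
    intro y hy
    have hy := (Set.mem_toFinset.1 hy).2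
    rw [← Set.ncard_coe_finset]
    refine (Set.ncard_le_ncard ?_ (Set.toFinite _)).trans hy
    intro x hx
    have hx := Finset.mem_filter.1 (Finset.mem_coe.1 hx)
    exact ⟨(Set.mem_toFinset.1 hx.1).1, hx.2⟩
  -- Charge each pair to an endpoint that has the other as a witness; every vertex is charged at
  -- most `k` times.
  have hsub : A ×ˢ B ⊆ (A.sigma fun x => B.filter fun y => W x y).image (fun p => (p.1, p.2)) ∪
      (B.sigma fun y => A.filter fun x => W y x).image (fun p => (p.2, p.1)) := by
    rintro ⟨x, y⟩ hxy
    obtain ⟨hx, hy⟩ := Finset.mem_product.1 hxy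
    rw [Finset.mem_union, Finset.mem_image, Finset.mem_image]
    rcases h x y (Set.mem_toFinset.1 hx).1 (Set.mem_toFinset.1 hy).1 with h | h
    · exact Or.inl ⟨⟨x, y⟩, by simp [hx, hy, h], rfl⟩
    · exact Or.inr ⟨⟨y, x⟩, by simp [hx, hy, h], rfl⟩
  have hcard : A.card * B.card ≤ A.card * k + B.card * k := by
    rw [← Finset.card_product]
    refine (Finset.card_le_card hsub).trans ((Finset.card_union_le _ _).trans (add_le_add ?_ ?_))
    · refine Finset.card_image_le.trans ?_
      rw [Finset.card_sigma]
      exact Finset.sum_le_card_nsmul _ _ _ hA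
    · refine Finset.card_image_le.trans ?_
      rw [Finset.card_sigma]
      exact Finset.sum_le_card_nsmul _ _ _ hB
  by_contra! hcon
  have h1 : 2 * k < A.card := by
    simpa [A, Set.ncard_eq_toFinset_card'] using hcon true
  have h2 : 2 * k < B.card := by
    simpa [B, Set.ncard_eq_toFinset_card'] using hcon false
  nlinarith

end Witness

/-- If there is a deletion set with at most `k` elements, then one arises in a single round from
a set of one of finitely many definable forms. -/
theorem exists_isDeletionSet_iff {n k : ℕ} {W : Fin n → Fin n → Prop} {col : Fin n → Bool}
    (hsame : ∀ x y, col x = col y → W x y → W y x)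
    (hdiff : (∀ x y, col x = true → col y = false → (W x y ∨ W y x)) ∨
      (∀ x y, col x = true → col y = false → (W x y ↔ W y x)) ∨
      ∃ c, ∀ x y, col x = c → col y = (!c) → ¬ W x y) :
    (∃ S : Set (Fin n), S.ncard ≤ k ∧ IsDeletionSet W S) ↔
      ∃ (c : Bool) (X : Set (Fin n)), (X = deletionRound W ∅ ∩ {v | col v = c} ∨
        ∃ F : HashSet n k, X = {v | F.Mem v ∧ v ∈ fewWitnesses W col k c}) ∧
        (deletionRound W X).ncard ≤ k ∧ IsDeletionSet W (deletionRound W X) := by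
  classical
  refine ⟨fun h => ?_, fun ⟨_, X, _, hX⟩ => ⟨_, hX⟩⟩
  obtain ⟨S, hSk, hS, hcl⟩ := exists_isDeletionSet_closed h
  -- The size bound is free for any start inside `S`; the three cases only have to show that the
  -- result is a deletion set.
  have hle : ∀ X, X ⊆ S → (deletionRound W X).ncard ≤ k := fun X hX =>
    (Set.ncard_le_ncard (deletionRound_subset hS hX) S.toFinite).trans hSk
  have hempty : ∀ c, deletionRound W ∅ ∩ {v | col v = c} ⊆ S := fun c =>
    Set.inter_subset_left.trans (deletionRound_subset hS (Set.empty_subset S))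
  rcases hdiff with h | h | ⟨c, h⟩
  · obtain ⟨c, hc⟩ := exists_ncard_fewWitnesses_le k h
    have hsub := inter_subset_fewWitnesses (col := col) hSk hcl c
    obtain ⟨F, hF⟩ := exists_hashSet (fewWitnesses W col k c).toFinset
      (S ∩ {v | col v = c}).toFinset (Set.toFinset_subset_toFinset.2 hsub)
      (by rwa [← Set.ncard_eq_toFinset_card'])
    simp only [Set.mem_toFinset] at hF
    have hX : {v | F.Mem v ∧ v ∈ fewWitnesses W col k c} = S ∩ {v | col v = c} := by
      ext v
      exact ⟨fun hv => (hF v hv.2).1 hv.1, fun hv => ⟨(hF v (hsub hv)).2 hv, hsub hv⟩⟩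
    exact ⟨c, _, Or.inr ⟨F, hX.symm⟩, hle _ Set.inter_subset_left,
      isDeletionSet_deletionRound_inter hS hsame c⟩
  · have hsymm : ∀ x y, W x y → W y x := by
      intro x y hxy
      rcases hx : col x <;> rcases hy : col y
      · exact hsame x y (hx.trans hy.symm) hxy
      · exact (h y x hy hx).2 hxy
      · exact (h x y hx hy).1 hxy
      · exact hsame x y (hx.trans hy.symm) hxy
    -- The colour is arbitrary here: with `W` symmetric, one round from any start works.
    exact ⟨true, _, Or.inl rfl, hle _ (hempty true), isDeletionSet_deletionRound_of_symm hsymm _⟩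
  · exact ⟨c, _, Or.inl rfl, hle _ (hempty c), isDeletionSet_deletionRound_of_independent hsame h⟩

/-! ### Quantifier-free formulas over graphs -/

/-- Satisfaction of a formula of which the free variables are indexed by `Fin m`. -/
def Holds {V : Type} (E : V → V → Prop) {m : ℕ} (ψ : Language.graph.BoundedFormula Empty m)
    (v : Fin m → V) : Prop :=
  @Language.BoundedFormula.Realize Language.graph V (graphStructure E) Empty m ψ default v

theorem exists_eq_var {m : ℕ} (t : Language.graph.Term (Empty ⊕ Fin m)) :
    ∃ i, t = Language.Term.var (Sum.inr i) := by
  cases t with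
  | var a =>
    cases a with
    | inl e => exact e.elim
    | inr i => exact ⟨i, rfl⟩
  | func f => exact (f : Empty).elim

/-- The truth of a quantifier-free formula depends only on the atomic type of the assignment. -/
theorem holds_congr {V V' : Type} {E : V → V → Prop} {E' : V' → V' → Prop} {m : ℕ}
    {v : Fin m → V} {v' : Fin m → V'} (heq : ∀ i j, v i = v j ↔ v' i = v' j)
    (hE : ∀ i j, E (v i) (v j) ↔ E' (v' i) (v' j))
    {ψ : Language.graph.BoundedFormula Empty m} (hψ : ψ.IsQF) : Holds E ψ v ↔ Holds E' ψ v' := by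
  induction hψ with
  | falsum => exact Iff.rfl
  | of_isAtomic h =>
    cases h with
    | equal t₁ t₂ =>
      obtain ⟨i, rfl⟩ := exists_eq_var t₁
      obtain ⟨j, rfl⟩ := exists_eq_var t₂
      exact heq i j
    | rel R ts =>
      cases R
      obtain ⟨i, hi⟩ := exists_eq_var (ts 0)
      obtain ⟨j, hj⟩ := exists_eq_var (ts 1)
      have key : ∀ {U : Type} (D : U → U → Prop) (u : Fin m → U),
          Holds D (Language.Relations.boundedFormula .adj ts) u ↔ D (u i) (u j) := by
        intro U D u
        change D (@Language.Term.realize _ _ (graphStructure D) _ _ (ts 0))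
          (@Language.Term.realize _ _ (graphStructure D) _ _ (ts 1)) ↔ _
        rw [hi, hj]
        exact Iff.rfl
      exact (key E v).trans ((hE i j).trans (key E' v').symm)
  | imp h₁ h₂ ih₁ ih₂ => exact imp_congr ih₁ ih₂

theorem models_all_ex {V : Type} (E : V → V → Prop)
    (ψ : Language.graph.BoundedFormula Empty 2) :
    Models E ψ.ex.all ↔ ∀ x, ∃ y, Holds E ψ ![x, y] := by
  let := graphStructure E
  change Language.BoundedFormula.Realize _ _ _ ↔ _
  rw [Language.BoundedFormula.realize_all]
  refine forall_congr' fun x => ?_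
  rw [Language.BoundedFormula.realize_ex]
  refine exists_congr fun y => ?_
  have : (Fin.snoc (Fin.snoc default x : Fin 1 → V) y : Fin 2 → V) = ![x, y] := by
    funext i
    fin_cases i <;> rfl
  change Language.BoundedFormula.Realize ψ default
    (Fin.snoc (Fin.snoc default x : Fin 1 → V) y : Fin 2 → V) ↔ _
  rw [this]
  rfl

theorem models_deleteVerts {V : Type} (E : V → V → Prop)
    {ψ : Language.graph.BoundedFormula Empty 2} (hψ : ψ.IsQF) (S : Finset V) :
    Models (deleteVerts E S) ψ.ex.all ↔ ∀ x, x ∉ S → ∃ y, y ∉ S ∧ Holds E ψ ![x, y] := by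
  have key : ∀ x y : {v : V // v ∉ S},
      Holds (deleteVerts E S) ψ ![x, y] ↔ Holds E ψ ![(x : V), (y : V)] := by
    intro x y
    refine holds_congr (fun i j => ?_) (fun i j => ?_) hψ <;>
      fin_cases i <;> fin_cases j <;> simp [deleteVerts, Subtype.ext_iff]
  rw [models_all_ex]
  constructor
  · intro h x hx
    obtain ⟨y, hy⟩ := h ⟨x, hx⟩
    exact ⟨y, y.2, (key _ _).1 hy⟩
  · rintro h ⟨x, hx⟩
    obtain ⟨y, hy, hxy⟩ := h x hx
    exact ⟨⟨y, hy⟩, (key ⟨x, hx⟩ ⟨y, hy⟩).2 hxy⟩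

/-- The truth value of a formula in two variables at a pair of different vertices, of which the
first one has the loop bit `a`, the second one has the loop bit `b`, and the edges between them
have the bits `c` and `d`. -/
def pairValue (ψ : Language.graph.BoundedFormula Empty 2) (a b c d : Bool) : Prop :=
  Holds (fun i j : Fin 2 => ![![a, c], ![d, b] ] i j = true) ψ ![0, 1]

/-- The truth value of a formula in two variables if both denote a vertex with the loop bit `a`. -/
def loopValue (ψ : Language.graph.BoundedFormula Empty 2) (a : Bool) : Prop :=
  Holds (fun _ _ : Unit => a = true) ψ ![(), ()]

section

variable {n : ℕ} (A : Fin n → Fin n → Bool) {ψ : Language.graph.BoundedFormula Empty 2}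

theorem holds_pair_of_ne (hψ : ψ.IsQF) {x y : Fin n} (h : x ≠ y) :
    Holds (fun u v => A u v = true) ψ ![x, y] ↔
      pairValue ψ (A x x) (A y y) (A x y) (A y x) := by
  refine holds_congr (fun i j => ?_) (fun i j => ?_) hψ <;>
    fin_cases i <;> fin_cases j <;> simp [h, h.symm]

theorem holds_pair_self (hψ : ψ.IsQF) (x : Fin n) :
    Holds (fun u v => A u v = true) ψ ![x, x] ↔ loopValue ψ (A x x) := by
  refine holds_congr (fun i j => ?_) (fun i j => ?_) hψ <;>
    fin_cases i <;> fin_cases j <;> simp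

end

/-- A table lookup: the truth value depends only on four matrix entries and on whether the two
vertices coincide. -/
theorem ParaDefinable.holds {ι : ℕ → ℕ → Type} {ψ : Language.graph.BoundedFormula Empty 2}
    (hψ : ψ.IsQF) (x y : ∀ n k, ι n k → Fin n) :
    ParaDefinable fun n k i A => Holds (fun u v => A u v = true) ψ ![x n k i, y n k i] := by
  have key : ParaDefinable fun n k (i : ι n k) A => ∃ t : Bool × Bool × Bool × Bool,
      (A (x n k i) (x n k i) = t.1 ∧ A (y n k i) (y n k i) = t.2.1 ∧
        A (x n k i) (y n k i) = t.2.2.1 ∧ A (y n k i) (x n k i) = t.2.2.2) ∧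
      (x n k i ≠ y n k i ∧ pairValue ψ t.1 t.2.1 t.2.2.1 t.2.2.2 ∨
        x n k i = y n k i ∧ loopValue ψ t.1) :=
    exists_index (κ := fun _ _ => Bool × Bool × Bool × Bool) (.const _)
      (and (and (adj_eq _ _ _) (and (adj_eq _ _ _) (and (adj_eq _ _ _) (adj_eq _ _ _))))
        (const _))
  refine key.congr fun n k i A => ?_
  by_cases h : x n k i = y n k i
  · rw [← h, holds_pair_self A hψ]
    simp
  · rw [holds_pair_of_ne A hψ h]
    constructor
    · exact fun hp => ⟨(_, _, _, _), ⟨rfl, rfl, rfl, rfl⟩, Or.inl ⟨h, hp⟩⟩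
    · rintro ⟨⟨a, b, c, d⟩, ⟨rfl, rfl, rfl, rfl⟩, ⟨-, hp⟩ | ⟨h', -⟩⟩
      exacts [hp, (h h').elim]

/-! ### Deciding vertex deletion by circuits -/

namespace ParaDefinable

variable {ι : ℕ → ℕ → Type} {W : (n : ℕ) → (Fin n → Fin n → Bool) → Fin n → Fin n → Prop}
  {X : (n k : ℕ) → ι n k → (Fin n → Fin n → Bool) → Set (Fin n)}

theorem deletionRound
    (hW : ParaDefinable (ι := fun n _ => Fin n × Fin n) fun n _ p A => W n A p.1 p.2)
    (hX : ParaDefinable (ι := fun n k => ι n k × Fin n) fun n k p A => p.2 ∈ X n k p.1 A) :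
    ParaDefinable (ι := fun n k => ι n k × Fin n) fun n k p A =>
      p.2 ∈ VertexDeletion.deletionRound (W n A) (X n k p.1 A) := by
  refine or hX (forall_vertex (imp (not ?_) (not ?_)))
  · exact hX.comp fun n k (p : (ι n k × Fin n) × Fin n) => (p.1.1, p.2)
  · exact hW.comp fun n k (p : (ι n k × Fin n) × Fin n) => (p.1.2, p.2)

theorem isDeletionSet
    (hW : ParaDefinable (ι := fun n _ => Fin n × Fin n) fun n _ p A => W n A p.1 p.2)
    (hX : ParaDefinable (ι := fun n k => ι n k × Fin n) fun n k p A => p.2 ∈ X n k p.1 A) :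
    ParaDefinable fun n k i A => IsDeletionSet (W n A) (X n k i A) := by
  refine forall_vertex (imp hX.not (exists_vertex (and (not ?_) ?_)))
  · exact hX.comp fun n k (p : (ι n k × Fin n) × Fin n) => (p.1.1, p.2)
  · exact hW.comp fun n k (p : (ι n k × Fin n) × Fin n) => (p.1.2, p.2)

theorem isDeletionSet_deletionRound
    (hW : ParaDefinable (ι := fun n _ => Fin n × Fin n) fun n _ p A => W n A p.1 p.2)
    (hX : ParaDefinable (ι := fun n k => ι n k × Fin n) fun n k p A => p.2 ∈ X n k p.1 A) :
    ParaDefinable fun n k i A =>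
      (VertexDeletion.deletionRound (W n A) (X n k i A)).ncard ≤ k ∧
        IsDeletionSet (W n A) (VertexDeletion.deletionRound (W n A) (X n k i A)) :=
  (ncard_le (hW.deletionRound hX)).and (hW.isDeletionSet (hW.deletionRound hX))

theorem exists_isDeletionSet
    (hW : ParaDefinable (ι := fun n _ => Fin n × Fin n) fun n _ p A => W n A p.1 p.2)
    (hsame : ∀ n A, (∀ u v : Fin n, A u v = A v u) → ∀ x y, A x x = A y y →
      W n A x y → W n A y x)
    (hdiff : ∀ n A, (∀ u v : Fin n, A u v = A v u) →
      (∀ x y, A x x = true → A y y = false → (W n A x y ∨ W n A y x)) ∨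
      (∀ x y, A x x = true → A y y = false → (W n A x y ↔ W n A y x)) ∨
      ∃ c, ∀ x y, A x x = c → A y y = (!c) → ¬ W n A x y) :
    ParaDefinable (ι := fun _ _ => Unit) fun n k _ A => (∀ u v, A u v = A v u) ∧
      ∃ S : Set (Fin n), S.ncard ≤ k ∧ IsDeletionSet (W n A) S := by
  have hcol : ∀ {κ : ℕ → ℕ → Type} (c : ∀ n k, κ n k → Bool) (v : ∀ n k, κ n k → Fin n),
      ParaDefinable fun n k i A => A (v n k i) (v n k i) = c n k i := fun c v => adj_eq v v c
  have hempty : ParaDefinable (ι := fun n _ => Bool × Fin n) fun n k p A =>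
      p.2 ∈ VertexDeletion.deletionRound (W n A) ∅ ∩ {v | A v v = p.1} :=
    and (hW.deletionRound (X := fun _ _ _ _ => ∅) (const fun _ _ _ => False)) (hcol _ _)
  have hfew : ParaDefinable (ι := fun n k => (Bool × HashSet n k) × Fin n) fun n k p A =>
      p.2 ∈ {v | p.1.2.Mem v ∧ v ∈ fewWitnesses (W n A) (fun v => A v v) k p.1.1} := by
    refine and (const _) (and (hcol _ _) (ncard_le (and (hcol _ _) ?_)))
    exact hW.comp fun n k (p : ((Bool × HashSet n k) × Fin n) × Fin n) => (p.1.2, p.2)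
  -- Asymmetric matrices are no-instances, so the circuit itself must test symmetry.
  have hsymm : ParaDefinable (ι := fun _ _ => Unit) fun n k _ A =>
      ∀ u v : Fin n, A u v = true → A v u = true :=
    forall_vertex (forall_vertex (imp (adj _ _) (adj _ _)))
  have h₁ : ParaDefinable (ι := fun _ _ => Unit) fun n k _ A => ∃ c : Bool,
      (VertexDeletion.deletionRound (W n A)
          (VertexDeletion.deletionRound (W n A) ∅ ∩ {v | A v v = c})).ncard ≤ k ∧
        IsDeletionSet (W n A) (VertexDeletion.deletionRound (W n A)
          (VertexDeletion.deletionRound (W n A) ∅ ∩ {v | A v v = c})) :=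
    exists_index (κ := fun _ _ => Bool) (.const _)
      ((hW.isDeletionSet_deletionRound (X := fun n _ c A =>
        VertexDeletion.deletionRound (W n A) ∅ ∩ {v | A v v = c}) hempty).comp
          fun n k (p : Unit × Bool) => p.2)
  have h₂ : ParaDefinable (ι := fun _ _ => Unit) fun n k _ A => ∃ q : Bool × HashSet n k,
      (VertexDeletion.deletionRound (W n A)
          {v | q.2.Mem v ∧ v ∈ fewWitnesses (W n A) (fun v => A v v) k q.1}).ncard ≤ k ∧
        IsDeletionSet (W n A) (VertexDeletion.deletionRound (W n A)
          {v | q.2.Mem v ∧ v ∈ fewWitnesses (W n A) (fun v => A v v) k q.1}) :=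
    exists_index (κ := fun n k => Bool × HashSet n k)
      (((ParaBounded.const 2).mul paraBounded_hashSet).mono fun n k => by
        rw [Fintype.card_prod, Fintype.card_bool])
      ((hW.isDeletionSet_deletionRound (X := fun n k q A =>
        {v | q.2.Mem v ∧ v ∈ fewWitnesses (W n A) (fun v => A v v) k q.1}) hfew).comp
          fun n k (p : Unit × (Bool × HashSet n k)) => p.2)
  refine (hsymm.and (h₁.or h₂)).congr fun n k _ A => ?_
  have hAA : (∀ u v, A u v = A v u) ↔ ∀ u v, A u v = true → A v u = true :=
    ⟨fun h u v hu => (h u v) ▸ hu, fun h u v => Bool.eq_iff_iff.2 ⟨h u v, h v u⟩⟩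
  rw [← hAA]
  refine and_congr_right ?_
  · intro hA
    rw [exists_isDeletionSet_iff (hsame n A hA) (hdiff n A hA)]
    constructor
    · rintro ⟨c, X, rfl | ⟨F, rfl⟩, hX⟩
      exacts [Or.inl ⟨c, hX⟩, Or.inr ⟨(c, F), hX⟩]
    · rintro (⟨c, hX⟩ | ⟨⟨c, F⟩, hX⟩)
      exacts [⟨c, _, Or.inl rfl, hX⟩, ⟨c, _, Or.inr ⟨F, rfl⟩, hX⟩]

end ParaDefinable

/-! ### Quantifier-free formulas in two variables over undirected graphs -/

section

variable {ψ : Language.graph.BoundedFormula Empty 2} {n : ℕ} {A : Fin n → Fin n → Bool}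

theorem holds_symm_of_loop_eq (hψ : ψ.IsQF) (hA : ∀ u v, A u v = A v u) {x y : Fin n}
    (hxy : A x x = A y y) (h : Holds (fun u v => A u v = true) ψ ![x, y]) :
    Holds (fun u v => A u v = true) ψ ![y, x] := by
  by_cases hne : x = y
  · subst hne
    exact h
  · rw [holds_pair_of_ne A hψ hne] at h
    rw [holds_pair_of_ne A hψ (Ne.symm hne), ← hxy, hA y x]
    rwa [← hxy, hA y x] at h

theorem holds_trichotomy (hψ : ψ.IsQF) (hA : ∀ u v, A u v = A v u) :
    (∀ x y, A x x = true → A y y = false → (Holds (fun u v => A u v = true) ψ ![x, y] ∨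
      Holds (fun u v => A u v = true) ψ ![y, x])) ∨
    (∀ x y, A x x = true → A y y = false → (Holds (fun u v => A u v = true) ψ ![x, y] ↔
      Holds (fun u v => A u v = true) ψ ![y, x])) ∨
    ∃ c, ∀ x y, A x x = c → A y y = (!c) → ¬ Holds (fun u v => A u v = true) ψ ![x, y] := by
  have key : ∀ x y, A x x = !(A y y) → (Holds (fun u v => A u v = true) ψ ![x, y] ↔
      pairValue ψ (A x x) (A y y) (A x y) (A x y)) := by
    intro x y h
    have hne : x ≠ y := by
      rintro rfl
      simp at h
    rw [holds_pair_of_ne A hψ hne, hA y x]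
  have h₁ : ∀ x y, A x x = true → A y y = false → (Holds (fun u v => A u v = true) ψ ![x, y] ↔
      pairValue ψ true false (A x y) (A x y)) := by
    intro x y hx hy
    rw [key x y (by simp [hx, hy]), hx, hy]
  have h₂ : ∀ x y, A x x = true → A y y = false → (Holds (fun u v => A u v = true) ψ ![y, x] ↔
      pairValue ψ false true (A x y) (A x y)) := by
    intro x y hx hy
    rw [key y x (by simp [hx, hy]), hx, hy, hA y x]
  by_cases hall : ∀ b, pairValue ψ true false b b ∨ pairValue ψ false true b b
  · refine Or.inl fun x y hx hy => ?_
    rw [h₁ x y hx hy, h₂ x y hx hy]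
    exact hall _
  · right
    push Not at hall
    -- For edge bit `b` neither direction holds, so the opposite bit decides: if both directions
    -- hold there, `W` is symmetric across the colours; otherwise some direction never holds.
    obtain ⟨b, hb₁, hb₂⟩ := hall
    by_cases hp : pairValue ψ true false (!b) (!b)
    · by_cases hq : pairValue ψ false true (!b) (!b)
      · refine Or.inl fun x y hx hy => ?_
        rw [h₁ x y hx hy, h₂ x y hx hy]
        by_cases hb : A x y = b
        · simp [hb, hb₁, hb₂]
        · simp [Bool.eq_not.2 hb, hp, hq]
      · refine Or.inr ⟨false, fun y x hy hx => ?_⟩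
        rw [h₂ x y hx hy]
        by_cases hb : A x y = b
        · rwa [hb]
        · rwa [Bool.eq_not.2 hb]
    · refine Or.inr ⟨true, fun x y hx hy => ?_⟩
      rw [h₁ x y hx hy]
      by_cases hb : A x y = b
      · rwa [hb]
      · rwa [Bool.eq_not.2 hb]

end

theorem mem_vdUndir_iff {n k : ℕ} (hn : 0 < n) {ψ : Language.graph.BoundedFormula Empty 2}
    (hψ : ψ.IsQF) (x : Fin (n * n) → Bool) :
    (List.ofFn x, k) ∈ vdUndir ψ.ex.all ↔
      (∀ u v : Fin n, x (finProdFinEquiv (u, v)) = x (finProdFinEquiv (v, u))) ∧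
      ∃ S : Set (Fin n), S.ncard ≤ k ∧
        IsDeletionSet (fun u v => Holds (fun u v => x (finProdFinEquiv (u, v)) = true) ψ ![u, v])
          S := by
  classical
  constructor
  · rintro ⟨m, A, -, hx, hA, S, hS, hM⟩
    obtain rfl : n = m := by
      have := congrArg List.length hx
      simpa [encode, Nat.mul_self_inj] using this
    have hxA : ∀ u v : Fin n, x (finProdFinEquiv (u, v)) = A u v := by
      intro u v
      have h := congrFun (List.ofFn_injective hx) (finProdFinEquiv (u, v))
      have h2 := finProdFinEquiv.symm_apply_apply (u, v)
      rw [h]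
      exact congrArg (fun p : Fin n × Fin n => A p.1 p.2) h2
    simp only [hxA]
    refine ⟨fun u v => Bool.eq_iff_iff.2 ⟨hA u v, hA v u⟩, S, by simpa using hS, ?_⟩
    exact (models_deleteVerts _ hψ S).1 hM
  · rintro ⟨hsymm, S, hS, hdel⟩
    refine ⟨n, fun u v => x (finProdFinEquiv (u, v)), hn, ?_, fun u v h => (hsymm v u).trans h,
      S.toFinset, by rwa [← Set.ncard_eq_toFinset_card'], ?_⟩
    · refine congrArg List.ofFn (funext fun i => congrArg x ?_)
      exact (finProdFinEquiv.apply_symm_apply i).symm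
    · rw [models_deleteVerts _ hψ]
      simpa [IsDeletionSet] using hdel

theorem vdUndir_all_ex_mem_paraAC0 {ψ : Language.graph.BoundedFormula Empty 2} (hψ : ψ.IsQF) :
    vdUndir ψ.ex.all ∈ ParaAC0 := by
  obtain ⟨d, s, ⟨c, f, hf, hs⟩, h⟩ := ParaDefinable.exists_isDeletionSet
    (W := fun n A x y => Holds (fun u v => A u v = true) ψ ![x, y])
    (ParaDefinable.holds hψ (fun n _ (p : Fin n × Fin n) => p.1) fun _ _ p => p.2)
    (fun n A hA x y => holds_symm_of_loop_eq hψ hA) fun n A hA => holds_trichotomy hψ hA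
  have key : ∀ N k, HasCircuit (N := N) (d + 1) ((f k + 1) * (N + 1) ^ c)
      fun x => (List.ofFn x, k) ∈ vdUndir ψ.ex.all := by
    intro N k
    -- Other lengths encode no graph and get an empty disjunction; `d + 1` and `f k + 1` leave room
    -- for this one gate.
    by_cases hN : ∃ n, 0 < n ∧ N = n * n
    · obtain ⟨n, hn, rfl⟩ := hN
      simp only [mem_vdUndir_iff hn hψ]
      refine (h n k ()).mono (Nat.le_succ d) ((hs n k).trans ?_)
      exact Nat.mul_le_mul (Nat.le_succ _)
        (Nat.pow_le_pow_left (Nat.succ_le_succ (Nat.le_mul_self n)) c)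
    · have hfalse : ∀ x : Fin N → Bool,
          (List.ofFn x, k) ∈ vdUndir ψ.ex.all ↔ ∃ _ : Empty, True := by
        intro x
        refine ⟨?_, fun ⟨e, _⟩ => e.elim⟩
        rintro ⟨n, A, hn, hx, -⟩
        refine (hN ⟨n, hn, ?_⟩).elim
        simpa [encode] using congrArg List.length hx
      simp only [hfalse]
      refine (HasCircuit.exists_index (ι := Empty) (d := d) (s := 0) (P := fun _ _ => True)
        fun e => e.elim).mono le_rfl ?_
      rw [mul_zero, zero_add]
      exact Nat.succ_le_of_lt (by positivity)
  choose C h1 h2 h3 using key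
  exact ⟨d + 1, c, fun k => f k + 1, C, (Primrec.succ.comp hf).to_comp,
    fun N k => ⟨h1 N k, h2 N k, h3 N k⟩⟩

end VertexDeletion

theorem mainTheorem8 :
    VertexDeletion.VDUndir [VertexDeletion.Quantifier.a, VertexDeletion.Quantifier.e] ⊆
      VertexDeletion.ParaAC0 := by
  rintro Q ⟨φ, ⟨_, rfl, ψ, rfl, hψ⟩, rfl⟩
  exact VertexDeletion.vdUndir_all_ex_mem_paraAC0 hψ
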